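/- Let $G$ be a finite connected graph without loops (multiple edges are allowed), with vertex set $I\sqcup\{r\}$, where $r$ is a distinguished root. Let $M_G=(A,\rho)$ be its megagreedoid: $A$ is the family of all $S\subseteq I$ such that the subgraph of $G$ induced on $S\cup\{r\}$ is connected, and for $S\in A$, $\rho(S)$ is the number of edges of $G$ that have at least one endpoint in $S$ and the other endpoint in $I$. (A megagreedoid on $I$ is a pair $(A,\rho)$ with $A\subseteq 2^I$ and $\rho:A\to\mathbb{R}$ such that: every nonempty $S\in A$ has an element $x\in S$ with $S\setminus\{x\}\in A$; for every $S\in A$ with $S\neq I$ there is $y\in I\setminus S$ with $S\cup\{y\}\in A$; and $\rho(Y\cup\{z\})-\rho(Y)\le\rho(X\cup\{z\})-\rho(X)$ whenever $X\subseteq Y$, $z\in I\setminus Y$ and $X,Y,X\cup\{z\},Y\cup\{z\}\in A$.) Let $P_{M_G}=\{x\in\mathbb{R}^I:\ \sum_{i\in S}x_i\le\rho(S)\text{ for all }S\in A,\ \sum_{i\in I}x_i=\rho(I)\}$ be the base polyhedron. A function $f:I\to\mathbb{R}$ is feasible if $\{i: f(i)\le c\}\in A$ for all $c\in\mathbb{R}$,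 and strongly feasible if there is $\varepsilon>0$ such that every $g:I\to\mathbb{R}$ with $|g(i)-f(i)|<\varepsilon$ for all $i\in I$ is feasible. It is generic if it is strongly feasible and the linear functional $x\mapsto\sum_{i\in I}f(i)x_i$ attains its minimum over $P_{M_G}$ at exactly one vertex of $P_{M_G}$. Then there is a (necessarily unique) polynomial $\chi(M_G,n)\in\mathbb{Q}[n]$ whose value at every integer $n\ge 0$ is the number of generic functions $f:I\to\{1,\dots,n\}$, and $$(-1)^{|I|}\,\chi(M_G,-1)$$ equals the number of acyclic orientations of $G$ in which $r$ is a sink and which contain a directed spanning tree rooted at $r$, all of whose edges are directed towards $r$. -/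

import Mathlib

/-- A megagreedoid on the finite set `I`: a family of feasible subsets of `I` together with a real
rank function on that family.  (The element to be removed is only asked for when `S` is nonempty,
the element to be added only when `S` is not all of `I`.) -/
structure Megagreedoid (I : Type*) [Fintype I] [DecidableEq I] where
  /-- the family of feasible sets -/
  feasible : Set (Finset I)
  /-- the rank function, defined on feasible sets only -/
  rank : feasible → ℝ
  exists_erase : ∀ S ∈ feasible, S.Nonempty → ∃ x ∈ S, S.erase x ∈ feasible
  exists_insert : ∀ S ∈ feasible, S ≠ Finset.univ → ∃ y, y ∉ S ∧ insert y S ∈ feasible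
  rank_submodular : ∀ (X Y : feasible) (z : I), X.1 ⊆ Y.1 → z ∉ Y.1 →
    ∀ (hX : insert z X.1 ∈ feasible) (hY : insert z Y.1 ∈ feasible),
      rank ⟨insert z Y.1, hY⟩ - rank Y ≤ rank ⟨insert z X.1, hX⟩ - rank X

namespace Megagreedoid

variable {I : Type*} [Fintype I] [DecidableEq I]

/-- The base polyhedron: `x(S) ≤ r(S)` for all feasible `S`, with equality for the whole set. -/
def basePolyhedron (M : Megagreedoid I) : Set (I → ℝ) :=
  {x | (∀ S : M.feasible, ∑ i ∈ S.1, x i ≤ M.rank S) ∧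
    ∀ h : Finset.univ ∈ M.feasible, ∑ i, x i = M.rank ⟨Finset.univ, h⟩}

/-- `f` is `r`-feasible: all its sublevel sets are feasible. -/
def IsFeasibleFun (M : Megagreedoid I) (f : I → ℝ) : Prop :=
  ∀ c : ℝ, Finset.univ.filter (fun i => f i ≤ c) ∈ M.feasible

/-- `f` is strongly `r`-feasible: every sufficiently small perturbation of `f` is `r`-feasible. -/
def IsStronglyFeasibleFun (M : Megagreedoid I) (f : I → ℝ) : Prop :=
  ∃ ε : ℝ, 0 < ε ∧ ∀ g : I → ℝ, (∀ i, |g i - f i| < ε) → M.IsFeasibleFun g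

/-- `f` is `r`-generic: it is strongly `r`-feasible, and the linear functional `x ↦ ∑ f i * x i` is
minimized over the base polyhedron at exactly one of its vertices. -/
def IsGeneric (M : Megagreedoid I) (f : I → ℝ) : Prop :=
  M.IsStronglyFeasibleFun f ∧
    ∃! v : I → ℝ, v ∈ M.basePolyhedron.extremePoints ℝ ∧
      IsMinOn (fun x : I → ℝ => ∑ i, f i * x i) M.basePolyhedron v

/-- The number of `r`-generic functions `f : I → {1, …, n}`. -/
noncomputable def genericCount (M : Megagreedoid I) (n : ℕ) : ℕ :=
  Set.ncard {f : I → ℕ | (∀ i, 1 ≤ f i ∧ f i ≤ n) ∧ M.IsGeneric (fun i => (f i : ℝ))}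

/-- `p` is the `r`-generic polynomial of `M`, that is `p(n)` is the number of `r`-generic functions
`I → {1, …, n}` for every natural number `n`.  There is at most one such `p`. -/
def IsGenericPolynomial (M : Megagreedoid I) (p : Polynomial ℚ) : Prop :=
  ∀ n : ℕ, p.eval (n : ℚ) = (M.genericCount n : ℚ)

end Megagreedoid

namespace Graph

/-! Rooted graphs on `I ⊔ {r}` are graphs (with multiple edges allowed) on `Option I`, whose root
`r` is `none`. -/

section Rooted

variable {I E : Type*}

/-- The set of vertices `S ∪ {r}`. -/
def withRoot (S : Finset I) : Set (Option I) := insert none (some '' (S : Set I))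

/-- `S ⊆ I` is feasible if `S ∪ {r}` induces a connected subgraph. -/
def rootedFeasible (G : Graph (Option I) E) : Set (Finset I) :=
  {S | (G.induce (withRoot S)).toSimpleGraph.Connected}

/-- The edges with at least one endpoint in `S`, and the other in `I`. -/
def incEdges (G : Graph (Option I) E) (S : Finset I) : Set E :=
  {e | ∃ u ∈ S, ∃ v : I, G.IsLink e (some u) (some v)}

/-- The number of edges with at least one endpoint in `S`, and the other in `I`. -/
noncomputable def inc (G : Graph (Option I) E) (S : Finset I) : ℕ := (G.incEdges S).ncard

lemma mem_withRoot_some {S : Finset I} {i : I} : some i ∈ withRoot S ↔ i ∈ S := by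
  simp [withRoot]

lemma none_mem_withRoot (S : Finset I) : none ∈ withRoot S := by simp [withRoot]

lemma withRoot_mono {S T : Finset I} (h : S ⊆ T) : withRoot S ⊆ withRoot T := by
  rintro (_ | i) hi
  · exact none_mem_withRoot T
  · exact mem_withRoot_some.2 (h (mem_withRoot_some.1 hi))

lemma empty_mem_rootedFeasible (G : Graph (Option I) E) : ∅ ∈ G.rootedFeasible := by
  refine (SimpleGraph.connected_iff_exists_forall_reachable _).2
    ⟨⟨none, none_mem_withRoot ∅⟩, ?_⟩
  rintro ⟨(_ | i), hi⟩
  · exact SimpleGraph.Reachable.refl _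
  · exact absurd (mem_withRoot_some.1 hi) (by simp)

lemma exists_insert_mem_rootedFeasible [DecidableEq I] (G : Graph (Option I) E) {S T : Finset I}
    (hS : S ∈ G.rootedFeasible) (hT : T ∈ G.rootedFeasible) (hTS : T ⊂ S) :
    ∃ x ∈ S, x ∉ T ∧ insert x T ∈ G.rootedFeasible := by
  obtain ⟨hsub, hne⟩ := Finset.ssubset_iff_subset_ne.1 hTS
  obtain ⟨s, hsS, hsT⟩ := Finset.exists_of_ssubset hTS
  let K : Set V(G.induce (withRoot S)) := {v | v.1 ∈ withRoot T}
  obtain ⟨p⟩ := SimpleGraph.Connected.preconnected hS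
    ⟨none, none_mem_withRoot S⟩ ⟨some s, mem_withRoot_some.2 hsS⟩
  obtain ⟨d, -, hd1, hd2⟩ := p.exists_boundary_dart K (none_mem_withRoot T)
    (fun h => hsT (mem_withRoot_some.1 h))
  obtain ⟨-, e, hl, -, -⟩ := d.adj
  have hw : d.snd.1 ∈ withRoot S := d.snd.2
  change d.fst.1 ∈ withRoot T at hd1
  change d.snd.1 ∉ withRoot T at hd2
  generalize d.fst.1 = u at hl hd1
  generalize d.snd.1 = w at hl hd2 hw
  obtain _ | x := w
  · exact absurd (none_mem_withRoot T) hd2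
  have hxT : x ∉ T := fun h => hd2 (mem_withRoot_some.2 h)
  refine ⟨x, mem_withRoot_some.1 hw, hxT, ?_⟩
  have hmono := withRoot_mono (Finset.subset_insert x T)
  have key : ∀ v (hv : v ∈ withRoot T),
      (G.induce (withRoot (insert x T))).toSimpleGraph.Reachable
        ⟨none, none_mem_withRoot _⟩ ⟨v, hmono hv⟩ := by
    intro v hv
    have h := SimpleGraph.Connected.preconnected hT
      ⟨none, none_mem_withRoot T⟩ ⟨v, hv⟩
    let φ : (G.induce (withRoot T)).toSimpleGraph →g
        (G.induce (withRoot (insert x T))).toSimpleGraph :=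
      { toFun := fun a => ⟨a.1, hmono a.2⟩
        map_rel' := by
          rintro a b ⟨hab, f, hf, hfa, hfb⟩
          exact ⟨fun h => hab (Subtype.ext (Subtype.mk.inj h)), f, hf, hmono hfa, hmono hfb⟩ }
    exact h.map φ
  refine (SimpleGraph.connected_iff_exists_forall_reachable _).2
    ⟨⟨none, none_mem_withRoot _⟩, ?_⟩
  rintro ⟨v, hv⟩
  by_cases hvT : v ∈ withRoot T
  · exact key v hvT
  · have hvx : v = some x := by
      obtain _ | i := v
      · exact absurd (none_mem_withRoot T) hvT
      · rcases Finset.mem_insert.1 (mem_withRoot_some.1 hv) with h | h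
        · rw [h]
        · exact absurd (mem_withRoot_some.2 h) hvT
    subst hvx
    refine (key u hd1).trans (SimpleGraph.Adj.reachable ⟨?_, e, hl, hmono hd1, hv⟩)
    intro h
    have hux : u = some x := congrArg Subtype.val h
    exact hd2 (by rw [← hux]; exact hd1)

lemma univ_mem_rootedFeasible [Fintype I] (G : Graph (Option I) E) (hV : V(G) = Set.univ)
    (hG : G.toSimpleGraph.Connected) : Finset.univ ∈ G.rootedFeasible := by
  have h : withRoot (Finset.univ : Finset I) = V(G) := by
    rw [hV]
    ext (_ | i) <;> simp [withRoot]
  change (G.induce (withRoot Finset.univ)).toSimpleGraph.Connected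
  rw [h, induce_vertexSet]
  exact hG

lemma inc_submodular [DecidableEq I] [Finite E] (G : Graph (Option I) E) {X Y : Finset I} (z : I)
    (hXY : X ⊆ Y) :
    (G.inc (insert z Y) : ℝ) - G.inc Y ≤ (G.inc (insert z X) : ℝ) - G.inc X := by
  have mono : ∀ {S T : Finset I}, S ⊆ T → G.incEdges S ⊆ G.incEdges T := by
    rintro S T h e ⟨u, hu, v, he⟩
    exact ⟨u, h hu, v, he⟩
  have hsub : G.incEdges (insert z Y) \ G.incEdges Y ⊆ G.incEdges (insert z X) \ G.incEdges X := by
    rintro e ⟨⟨u, hu, v, he⟩, hn⟩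
    refine ⟨?_, fun h => hn (mono hXY h)⟩
    rcases Finset.mem_insert.1 hu with rfl | hu
    · exact ⟨u, Finset.mem_insert_self _ _, v, he⟩
    · exact absurd ⟨u, hu, v, he⟩ hn
  have h1 := Set.ncard_sdiff_add_ncard_of_subset (mono (Finset.subset_insert z Y)) (Set.toFinite _)
  have h2 := Set.ncard_sdiff_add_ncard_of_subset (mono (Finset.subset_insert z X)) (Set.toFinite _)
  have h3 := Set.ncard_le_ncard hsub (Set.toFinite _)
  have h4 : G.inc (insert z Y) + G.inc X ≤ G.inc (insert z X) + G.inc Y := by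
    unfold inc
    omega
  have h5 : (G.inc (insert z Y) : ℝ) + G.inc X ≤ G.inc (insert z X) + G.inc Y := by
    exact_mod_cast h4
  linarith

/-- The megagreedoid `M_G` of a connected rooted graph `G` with vertex set `I ⊔ {r}`. -/
noncomputable def megagreedoid [Fintype I] [DecidableEq I] [Finite E] (G : Graph (Option I) E)
    (hV : V(G) = Set.univ) (hG : G.toSimpleGraph.Connected) : Megagreedoid I where
  feasible := G.rootedFeasible
  rank := fun S => (G.inc S.1 : ℝ)
  exists_erase := by
    intro S hS hne
    classical
    obtain ⟨T, hT, hmax⟩ := Finset.exists_max_image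
      (Finset.univ.filter fun T : Finset I => T ∈ G.rootedFeasible ∧ T ⊂ S) Finset.card
      ⟨∅, by simpa [G.empty_mem_rootedFeasible] using hne⟩
    obtain ⟨hTf, hTS⟩ := (Finset.mem_filter.1 hT).2
    obtain ⟨x, hxS, hxT, hx⟩ := G.exists_insert_mem_rootedFeasible hS hTf hTS
    refine ⟨x, hxS, ?_⟩
    have hsub : insert x T ⊆ S := Finset.insert_subset hxS hTS.subset
    by_cases heq : insert x T = S
    · rw [← heq, Finset.erase_insert hxT]
      exact hTf
    · have h := hmax (insert x T)
        (Finset.mem_filter.2 ⟨Finset.mem_univ _, hx, Finset.ssubset_iff_subset_ne.2 ⟨hsub, heq⟩⟩)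
      rw [Finset.card_insert_of_notMem hxT] at h
      omega
  exists_insert := by
    intro S hS hne
    obtain ⟨x, -, hxS, hx⟩ := G.exists_insert_mem_rootedFeasible
      (G.univ_mem_rootedFeasible hV hG) hS (Finset.ssubset_univ_iff.2 hne)
    exact ⟨x, hxS, hx⟩
  rank_submodular := fun _ _ z hXY _ _ _ => G.inc_submodular z hXY

end Rooted

/-- An orientation of a loopless graph: each edge gets one endpoint as its tail and the other one
as its head. -/
@[ext]
structure Orientation {V E : Type*} (G : Graph V E) where
  tail : E(G) → V
  head : E(G) → V
  isLink : ∀ e : E(G), G.IsLink e (tail e) (head e)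

namespace Orientation

variable {V E : Type*} {G : Graph V E}

/-- Some edge of the set `T` is directed from `u` to `v`. -/
def ArcIn (o : G.Orientation) (T : Set E(G)) (u v : V) : Prop :=
  ∃ e ∈ T, o.tail e = u ∧ o.head e = v

/-- There is no directed cycle. -/
def IsAcyclic (o : G.Orientation) : Prop :=
  ∀ v, ¬ Relation.TransGen (o.ArcIn Set.univ) v v

/-- No edge is directed away from `r`. -/
def IsSink (o : G.Orientation) (r : V) : Prop := ∀ e, o.tail e ≠ r

/-- The edge set `T` is a directed spanning tree rooted at `r`, with all edges directed towards the
root: no edge of `T` leaves `r`, exactly one edge of `T` leaves each other vertex, and `r` can be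
reached from every vertex along the edges of `T`. -/
structure IsDirectedSpanningTree (o : G.Orientation) (r : V) (T : Set E(G)) : Prop where
  root : ∀ e ∈ T, o.tail e ≠ r
  existsUnique : ∀ v ∈ V(G), v ≠ r → ∃! e, e ∈ T ∧ o.tail e = v
  reach : ∀ v ∈ V(G), Relation.ReflTransGen (o.ArcIn T) v r

end Orientation

end Graph

/-! A function `f` is strongly feasible exactly when every vertex of `I` is adjacent to the root or
to a vertex of smaller value (`isStronglyFeasibleFun_iff_hasDescent`). For such an `f`, the greedy
algorithm applies: any properly coloured refinement `h` of `f` yields a minimizing vertex of the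
base polyhedron, whose coordinate at `k` counts the edges from `k` to larger values of `h`. Breaking
a tie across an edge in two ways yields two distinct vertices, so genericity also requires adjacent
vertices of `I` to have distinct values, and this is enough (`isGeneric_iff`).

Give the root the value 0 and orient each edge towards its smaller value. A generic `f` with
positive values then amounts to an acyclic orientation with the root as its only sink, together with
a labelling that decreases strictly along arcs. The generic count is therefore a sum of strict order
polynomials (`genericCount_eq_sum`), each with value `(-1) ^ |I|` at `-1`
(`exists_strictOrderPolynomial`). In an acyclic orientation with the root as a sink, following
outgoing edges must end at a sink, so a spanning tree directed to the root exists exactly when there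
is no other sink. -/

/-! ### Strict order polynomials and their value at `-1`. -/

section StrictOrderPolynomial

/-- On monomials, the Bernoulli polynomials provide the antidifference. The identity holds at every
rational, so it can later be used at `x = -1`. -/
lemma Polynomial.exists_eval_add_one_eq (q : Polynomial ℚ) :
    ∃ p : Polynomial ℚ, (∀ x, p.eval (x + 1) = p.eval x + q.eval x) ∧ p.eval 0 = 0 := by
  induction q using Polynomial.induction_on' with
  | add q₁ q₂ h₁ h₂ =>
    obtain ⟨p₁, h₁, h₁'⟩ := h₁
    obtain ⟨p₂, h₂, h₂'⟩ := h₂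
    refine ⟨p₁ + p₂, fun x => ?_, by simp [h₁', h₂']⟩
    simp only [Polynomial.eval_add, h₁, h₂]
    ring
  | monomial n a =>
    refine ⟨Polynomial.C (a / (n + 1)) * (Polynomial.bernoulli (n + 1) -
      Polynomial.C ((Polynomial.bernoulli (n + 1)).eval 0)), fun x => ?_, by simp⟩
    have h := Polynomial.bernoulli_eval_one_add (n + 1) x
    have hn : (n : ℚ) + 1 ≠ 0 := by positivity
    rw [add_comm] at h
    simp only [Polynomial.eval_mul, Polynomial.eval_C, Polynomial.eval_sub, h,
      Polynomial.eval_monomial]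
    push_cast
    field_simp
    ring

variable {I : Type*} [Fintype I] [DecidableEq I]

open Classical in
/-- The maps `S → {1, …, n}`, extended by zero, that decrease strictly along `R`. -/
noncomputable def strictMaps (R : I → I → Prop) (S : Finset I) (n : ℕ) : Finset (I → ℕ) :=
  (Fintype.piFinset fun i => if i ∈ S then Finset.Icc 1 n else {0}).filter
    fun f => ∀ u ∈ S, ∀ v ∈ S, R u v → f v < f u

lemma mem_strictMaps {R : I → I → Prop} {S : Finset I} {n : ℕ} {f : I → ℕ} :
    f ∈ strictMaps R S n ↔ (∀ i ∈ S, 1 ≤ f i ∧ f i ≤ n) ∧ (∀ i ∉ S, f i = 0) ∧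
      ∀ u ∈ S, ∀ v ∈ S, R u v → f v < f u := by
  simp only [strictMaps, Finset.mem_filter, Fintype.mem_piFinset, ← and_assoc]
  refine and_congr_left fun _ => ⟨fun h => ⟨fun i hi => ?_, fun i hi => ?_⟩, fun h i => ?_⟩
  · simpa [hi] using h i
  · simpa [hi] using h i
  · by_cases hi : i ∈ S
    · simpa [hi] using h.1 i hi
    · simpa [hi] using h.2 i hi

open Classical in
/-- The elements of `S` that are not the target of an arc from within `S`. -/
noncomputable def maximalIn (R : I → I → Prop) (S : Finset I) : Finset I :=
  S.filter fun v => ∀ u ∈ S, ¬ R u v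

/-- Sort the maps by the set `T` on which the top value `n + 1` is taken. An arc from `S` into `T`
would need a value above `n + 1`, so `T` consists of maximal elements; conversely the values on any
set of maximal elements can be raised to the top. -/
lemma card_strictMaps_succ (R : I → I → Prop) (S : Finset I) (n : ℕ) :
    (strictMaps R S (n + 1)).card =
      ∑ T ∈ (maximalIn R S).powerset, (strictMaps R (S \ T) n).card := by
  classical
  rw [Finset.card_eq_sum_card_fiberwise (f := fun f => S.filter fun i => f i = n + 1)
    (t := (maximalIn R S).powerset)]
  · refine Finset.sum_congr rfl fun T hT => ?_
    rw [Finset.mem_powerset] at hT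
    refine Finset.card_bij' (fun f _ i => if i ∈ T then 0 else f i)
      (fun g _ i => if i ∈ T then n + 1 else g i) ?_ ?_ ?_ ?_
    · intro f hf
      obtain ⟨hf, hfT⟩ := Finset.mem_filter.1 hf
      obtain ⟨h1, h2, h3⟩ := mem_strictMaps.1 hf
      have hT' : ∀ i, i ∈ T ↔ i ∈ S ∧ f i = n + 1 := fun i => by
        rw [← hfT, Finset.mem_filter]
      refine mem_strictMaps.2 ⟨fun i hi => ?_, fun i hi => ?_, fun u hu v hv huv => ?_⟩
      · obtain ⟨hiS, hiT⟩ := Finset.mem_sdiff.1 hi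
        have := h1 i hiS
        have : f i ≠ n + 1 := fun h => hiT ((hT' i).2 ⟨hiS, h⟩)
        simp only [hiT, if_false]
        omega
      · by_cases hiT : i ∈ T
        · simp [hiT]
        · simp only [hiT, if_false]
          exact h2 i fun h => hi (Finset.mem_sdiff.2 ⟨h, hiT⟩)
      · obtain ⟨huS, huT⟩ := Finset.mem_sdiff.1 hu
        obtain ⟨hvS, hvT⟩ := Finset.mem_sdiff.1 hv
        simpa only [huT, hvT, if_false] using h3 u huS v hvS huv
    · intro g hg
      obtain ⟨h1, h2, h3⟩ := mem_strictMaps.1 hg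
      have hTS : ∀ i ∈ T, i ∈ S := fun i hi => (Finset.mem_filter.1 (hT hi)).1
      refine Finset.mem_filter.2 ⟨mem_strictMaps.2 ⟨fun i hi => ?_, fun i hi => ?_,
        fun u hu v hv huv => ?_⟩, ?_⟩
      · by_cases hiT : i ∈ T
        · simp [hiT]
        · have := h1 i (Finset.mem_sdiff.2 ⟨hi, hiT⟩)
          simp only [hiT, if_false]
          omega
      · have hiT : i ∉ T := fun h => hi (hTS i h)
        simp only [hiT, if_false]
        exact h2 i fun h => hi (Finset.mem_sdiff.1 h).1
      · have hvT : v ∉ T := fun h => (Finset.mem_filter.1 (hT h)).2 u hu huv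
        have hv' := Finset.mem_sdiff.2 ⟨hv, hvT⟩
        have := h1 v hv'
        by_cases huT : u ∈ T
        · simp only [huT, hvT, if_false, if_true]
          omega
        · simpa only [huT, hvT, if_false] using h3 u (Finset.mem_sdiff.2 ⟨hu, huT⟩) v hv' huv
      · ext i
        by_cases hiT : i ∈ T
        · simp [hiT, hTS i hiT]
        · simp only [Finset.mem_filter, hiT, if_false, iff_false, not_and]
          intro hi
          have := h1 i (Finset.mem_sdiff.2 ⟨hi, hiT⟩)
          omega
    · intro f hf
      obtain ⟨-, hfT⟩ := Finset.mem_filter.1 hf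
      funext i
      by_cases hiT : i ∈ T
      · have hi : f i = n + 1 := by
          rw [← hfT] at hiT
          exact (Finset.mem_filter.1 hiT).2
        simp [hiT, hi]
      · simp [hiT]
    · intro g hg
      funext i
      by_cases hiT : i ∈ T
      · have hi : g i = 0 :=
          (mem_strictMaps.1 hg).2.1 i fun h => (Finset.mem_sdiff.1 h).2 hiT
        simp [hiT, hi]
      · simp [hiT]
  · intro f hf
    obtain ⟨h1, h2, h3⟩ := mem_strictMaps.1 (Finset.mem_coe.1 hf)
    refine Finset.mem_coe.2 (Finset.mem_powerset.2 fun v hv => ?_)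
    obtain ⟨hvS, hv⟩ := Finset.mem_filter.1 hv
    refine Finset.mem_filter.2 ⟨hvS, fun u hu huv => ?_⟩
    have := h3 u hu v hvS huv
    have := h1 u hu
    omega

lemma strictMaps_zero {R : I → I → Prop} {S : Finset I} (hS : S.Nonempty) :
    strictMaps R S 0 = ∅ := by
  refine Finset.eq_empty_of_forall_notMem fun f hf => ?_
  obtain ⟨i, hi⟩ := hS
  have := (mem_strictMaps.1 hf).1 i hi
  omega

lemma card_strictMaps_empty (R : I → I → Prop) (n : ℕ) : (strictMaps R ∅ n).card = 1 := by
  refine Finset.card_eq_one.2 ⟨0, ?_⟩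
  ext f
  simp [mem_strictMaps, funext_iff]

/-- Reciprocity for strict order polynomials. -/
lemma exists_strictOrderPolynomial {R : I → I → Prop} (hR : ∀ v, ¬ Relation.TransGen R v v)
    (S : Finset I) : ∃ p : Polynomial ℚ, (∀ n : ℕ, p.eval (n : ℚ) = (strictMaps R S n).card) ∧
      p.eval (-1) = (-1) ^ S.card := by
  classical
  induction S using Finset.strongInduction with
  | H S ih =>
  rcases S.eq_empty_or_nonempty with rfl | hS
  · exact ⟨1, fun n => by simp [card_strictMaps_empty], by simp⟩
  -- Acyclicity enters only here: on a finite type it makes `TransGen R` well founded.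
  have hmax : (maximalIn R S).Nonempty := by
    have : Std.Irrefl (Relation.TransGen R) := ⟨hR⟩
    obtain ⟨m, hm, hmin⟩ :=
      (Finite.wellFounded_of_trans_of_irrefl (Relation.TransGen R)).has_min (S : Set I) hS
    exact ⟨m, Finset.mem_filter.2 ⟨hm, fun u hu h => hmin u hu (.single h)⟩⟩
  have hsub : maximalIn R S ⊆ S := Finset.filter_subset _ _
  choose! P hP hP' using ih
  have hlt : ∀ T ∈ (maximalIn R S).powerset.erase ∅, T ⊆ S ∧ S \ T ⊂ S := fun T hT => by
    obtain ⟨hne, hT⟩ := Finset.mem_erase.1 hT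
    have hTS := (Finset.mem_powerset.1 hT).trans hsub
    exact ⟨hTS, Finset.sdiff_ssubset hTS (Finset.nonempty_iff_ne_empty.2 hne)⟩
  -- The term `T = ∅` of the recursion is the count for `S` itself, so the remaining terms form its
  -- first difference.
  obtain ⟨p, hp, hp0⟩ := Polynomial.exists_eval_add_one_eq
    (∑ T ∈ (maximalIn R S).powerset.erase ∅, P (S \ T))
  refine ⟨p, fun n => ?_, ?_⟩
  · induction n with
    | zero => simp [hp0, strictMaps_zero hS]
    | succ n ihn =>
      rw [card_strictMaps_succ, ← Finset.add_sum_erase _ _ (Finset.empty_mem_powerset _)]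
      push_cast
      rw [hp, ihn, Finset.sdiff_empty, Polynomial.eval_finsetSum]
      congr 1
      exact Finset.sum_congr rfl fun T hT => hP _ (hlt T hT).2 n
  -- At `-1` the difference equation reads `p(0) = p(-1) + ∑ P (S \ T) (-1)` with `p(0) = 0`. The
  -- alternating sum over all subsets of the nonempty set of maximal elements vanishes, so its part
  -- over `T ≠ ∅` is `-1`.
  · have h := hp (-1)
    have hsum : ∑ T ∈ (maximalIn R S).powerset.erase ∅, (P (S \ T)).eval (-1) =
        -(-1 : ℚ) ^ S.card := by
      have h1 : ∑ T ∈ (maximalIn R S).powerset.erase ∅, (P (S \ T)).eval (-1) =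
          ∑ T ∈ (maximalIn R S).powerset.erase ∅, (-1 : ℚ) ^ S.card * (-1) ^ T.card := by
        refine Finset.sum_congr rfl fun T hT => ?_
        obtain ⟨hTS, hlt⟩ := hlt T hT
        rw [hP' _ hlt, ← Finset.card_sdiff_add_card_eq_card hTS, pow_add, mul_assoc,
          ← pow_add, Even.neg_one_pow ⟨_, rfl⟩, mul_one]
      have h2 := Finset.add_sum_erase (maximalIn R S).powerset (fun T => (-1 : ℚ) ^ T.card)
        (Finset.empty_mem_powerset _)
      have h3 : ∑ T ∈ (maximalIn R S).powerset, (-1 : ℚ) ^ T.card = 0 := by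
        exact_mod_cast Finset.sum_powerset_neg_one_pow_card_of_nonempty hmax
      rw [h3, Finset.card_empty, pow_zero] at h2
      rw [h1, ← Finset.mul_sum]
      linear_combination (-1 : ℚ) ^ S.card * h2
    rw [neg_add_cancel, hp0, Polynomial.eval_finsetSum, hsum] at h
    linarith

end StrictOrderPolynomial

/-! ### Strong feasibility as a local condition on the graph. -/

namespace Graph

section Generic

variable {I E : Type*} {α : Type*} [LinearOrder α]

/-- Every vertex of `I` is adjacent to the root or to a vertex with a smaller value of `f`. -/
def HasDescent (G : Graph (Option I) E) (f : I → α) : Prop :=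
  ∀ i, G.Adj (some i) none ∨ ∃ j, f j < f i ∧ G.Adj (some i) (some j)

/-- Adjacent vertices of `I` have different values of `f`. -/
def IsProper (G : Graph (Option I) E) (f : I → α) : Prop :=
  ∀ i j, G.Adj (some i) (some j) → f i ≠ f j

/-- The set `S` contains all elements whose value of `f` is below that of an element of `S`. -/
def IsLowerFor (f : I → α) (S : Finset I) : Prop :=
  ∀ i ∈ S, ∀ j, f j < f i → j ∈ S

lemma reachable_induce {G : Graph (Option I) E} {X : Set (Option I)} {u v : Option I}
    (hu : u ∈ X) (hv : v ∈ X) (h : G.Adj u v) :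
    (G.induce X).toSimpleGraph.Reachable ⟨u, hu⟩ ⟨v, hv⟩ := by
  by_cases huv : u = v
  · subst huv
    rfl
  · obtain ⟨e, he⟩ := h
    exact SimpleGraph.Adj.reachable ⟨fun h => huv (congrArg Subtype.val h), e, he, hu, hv⟩

/-- Descending along `f` from a vertex of `S` stays in `S` and must stop at a neighbour of the root.
-/
lemma HasDescent.mem_rootedFeasible [Finite I] {G : Graph (Option I) E} {f : I → α}
    (h : G.HasDescent f) {S : Finset I} (hS : IsLowerFor f S) : S ∈ G.rootedFeasible := by
  refine (SimpleGraph.connected_iff_exists_forall_reachable _).2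
    ⟨⟨none, none_mem_withRoot S⟩, ?_⟩
  have key : ∀ i (hi : some i ∈ withRoot S), (G.induce (withRoot S)).toSimpleGraph.Reachable
      ⟨none, none_mem_withRoot S⟩ ⟨some i, hi⟩ := by
    have : IsTrans I (fun a b => f a < f b) := ⟨fun _ _ _ => lt_trans⟩
    have : Std.Irrefl (fun a b : I => f a < f b) := ⟨fun _ => lt_irrefl _⟩
    intro i
    induction i using (Finite.wellFounded_of_trans_of_irrefl (fun a b : I => f a < f b)).induction
      with
    | h i ih =>
      intro hi
      rcases h i with h | ⟨j, hj, h⟩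
      · exact (reachable_induce _ _ h).symm
      · have hjS : some j ∈ withRoot S :=
          mem_withRoot_some.2 (hS i (mem_withRoot_some.1 hi) j hj)
        exact (ih j hj hjS).trans (reachable_induce _ _ h).symm
  rintro ⟨_ | i, hi⟩
  · rfl
  · exact key i hi

lemma exists_adj_of_mem_rootedFeasible {G : Graph (Option I) E} {S : Finset I}
    (hS : S ∈ G.rootedFeasible) {i : I} (hi : i ∈ S) :
    G.Adj (some i) none ∨ ∃ j ∈ S, j ≠ i ∧ G.Adj (some i) (some j) := by
  let K : Set V(G.induce (withRoot S)) := {v | v.1 = some i}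
  obtain ⟨p⟩ := SimpleGraph.Connected.preconnected hS
    ⟨some i, mem_withRoot_some.2 hi⟩ ⟨none, none_mem_withRoot S⟩
  obtain ⟨d, -, hd1, hd2⟩ := p.exists_boundary_dart K rfl (fun h => Option.some_ne_none i h.symm)
  obtain ⟨-, e, hl, -, -⟩ := d.adj
  have hw : d.snd.1 ∈ withRoot S := d.snd.2
  change d.fst.1 = some i at hd1
  change d.snd.1 ≠ some i at hd2
  rw [hd1] at hl
  generalize d.snd.1 = w at hl hd2 hw
  obtain _ | j := w
  · exact .inl ⟨e, hl⟩
  · exact .inr ⟨j, mem_withRoot_some.1 hw, fun h => hd2 (by rw [h]), e, hl⟩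

variable [Fintype I] [DecidableEq I] [Finite E]

lemma isStronglyFeasibleFun_iff_hasDescent (G : Graph (Option I) E) (hV : V(G) = Set.univ)
    (hG : G.toSimpleGraph.Connected) (f : I → ℝ) :
    (G.megagreedoid hV hG).IsStronglyFeasibleFun f ↔ G.HasDescent f := by
  constructor
  · rintro ⟨ε, hε, h⟩ i
    -- Raising the vertices tied with `i` (and all higher ones) turns the sublevel set at `f i` into
    -- `{f < f i} ∪ {i}`, where `i` must have a neighbour.
    have hg := h (fun j => if f j < f i ∨ j = i then f j else f j + ε / 2) (fun j => by
      split_ifs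
      · simpa
      · rw [add_sub_cancel_left, abs_of_pos (by linarith)]
        linarith) (f i)
    have hmem : ∀ j, j ∈ Finset.univ.filter
        (fun j => (if f j < f i ∨ j = i then f j else f j + ε / 2) ≤ f i) ↔
          f j < f i ∨ j = i := fun j => by
      simp only [Finset.mem_filter, Finset.mem_univ, true_and]
      split_ifs with hj
      · simp only [hj, iff_true]
        rcases hj with hj | rfl
        · exact hj.le
        · exact le_rfl
      · simp only [hj, iff_false, not_le]
        push Not at hj
        linarith [hj.1]
    rcases exists_adj_of_mem_rootedFeasible hg ((hmem i).2 (.inr rfl)) with h | ⟨j, hj, hji, h⟩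
    · exact .inl h
    · exact .inr ⟨j, ((hmem j).1 hj).resolve_right hji, h⟩
  · intro h
    -- With `ε` half the smallest gap, perturbations below `ε` preserve strict inequalities, so
    -- sublevel sets of `g` are lower sets for `f`.
    obtain ⟨ε, hε, hgap⟩ : ∃ ε : ℝ, 0 < ε ∧ ∀ i j, f j < f i → f j + 2 * ε ≤ f i := by
      let s := (Finset.univ : Finset (I × I)).filter fun p => f p.2 < f p.1
      rcases s.eq_empty_or_nonempty with hs | hs
      · refine ⟨1, one_pos, fun i j hij => ?_⟩
        have : (i, j) ∈ s := by simpa [s] using hij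
        simp [hs] at this
      · obtain ⟨p, hp, hmin⟩ := s.exists_min_image (fun p => f p.1 - f p.2) hs
        refine ⟨(f p.1 - f p.2) / 2, ?_, fun i j hij => ?_⟩
        · have : f p.2 < f p.1 := by simpa [s] using hp
          linarith
        · have := hmin (i, j) (by simpa [s] using hij)
          dsimp only at this
          linarith
    refine ⟨ε, hε, fun g hg c => ?_⟩
    have hlt : ∀ i j, f j < f i → g j < g i := fun i j hij => by
      have h1 := abs_lt.1 (hg i)
      have h2 := abs_lt.1 (hg j)
      linarith [hgap i j hij]
    refine h.mem_rootedFeasible fun i hi j hj => ?_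
    simp only [Finset.mem_filter, Finset.mem_univ, true_and] at hi ⊢
    exact (hlt i j hj).le.trans hi

end Generic

end Graph

/-! ### The greedy algorithm on the base polyhedron. -/

/-- Abel summation: `f i` is the number of levels `c` with `c < f i`. It reduces the linear
functional to sums over sublevel sets, which the polyhedron bounds. -/
lemma sum_natCast_mul_eq {I : Type*} [Fintype I] {f : I → ℕ} {n : ℕ} (hn : ∀ i, f i ≤ n)
    {y : I → ℝ} (hy : ∑ i, y i = 0) :
    ∑ i, (f i : ℝ) * y i = ∑ c ∈ Finset.range n, -∑ i with f i ≤ c, y i := by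
  have h1 : ∀ i, (f i : ℝ) * y i = ∑ c ∈ Finset.range n, if f i ≤ c then 0 else y i := fun i => by
    rw [Finset.sum_ite, Finset.sum_const_zero, zero_add, Finset.sum_const, nsmul_eq_mul]
    have : (Finset.range n).filter (fun c => ¬ f i ≤ c) = Finset.range (f i) := by
      ext c
      have := hn i
      simp only [Finset.mem_filter, Finset.mem_range]
      omega
    rw [this, Finset.card_range]
  rw [Finset.sum_congr rfl fun i _ => h1 i, Finset.sum_comm]
  refine Finset.sum_congr rfl fun c _ => ?_
  have h2 := Finset.sum_filter_add_sum_filter_not Finset.univ (fun i => f i ≤ c) y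
  rw [Finset.sum_ite, Finset.sum_const_zero, zero_add]
  linarith

namespace Graph

section BasePolyhedron

variable {I E : Type*} {α : Type*} [LinearOrder α]

/-- The edges that join `k` to a vertex of `I` with a larger value of `h`. -/
def outEdges (G : Graph (Option I) E) (h : I → α) (k : I) : Set E :=
  {e | ∃ l, G.IsLink e (some k) (some l) ∧ h k < h l}

/-- The number of edges that join `k` to a vertex of `I` with a larger value of `h`. -/
noncomputable def outDeg (G : Graph (Option I) E) (h : I → α) (k : I) : ℝ :=
  (G.outEdges h k).ncard

lemma iUnion_outEdges_subset (G : Graph (Option I) E) (h : I → α) (S : Finset I) :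
    (⋃ k ∈ S, G.outEdges h k) ⊆ G.incEdges S := by
  intro e he
  simp only [Set.mem_iUnion] at he
  obtain ⟨k, hk, l, hl, -⟩ := he
  exact ⟨k, hk, l, hl⟩

lemma isLowerFor_lt [Fintype I] (f : I → α) (i : I) : IsLowerFor f (Finset.univ.filter fun j => f j < f i) := by
  intro a ha b hb
  simp only [Finset.mem_filter, Finset.mem_univ, true_and] at ha ⊢
  exact hb.trans ha

lemma isLowerFor_le [Fintype I] (f : I → ℕ) (c : ℕ) : IsLowerFor f (Finset.univ.filter fun j => f j ≤ c) := by
  intro a ha b hb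
  simp only [Finset.mem_filter, Finset.mem_univ, true_and] at ha ⊢
  exact hb.le.trans ha

lemma isLowerFor_le_of_refinement [Fintype I] {f : I → ℕ} {h : I → α} (hfh : ∀ i j, f i < f j → h i < h j)
    (c : ℕ) : IsLowerFor h (Finset.univ.filter fun j => f j ≤ c) := by
  intro a ha b hb
  simp only [Finset.mem_filter, Finset.mem_univ, true_and] at ha ⊢
  exact (le_of_not_gt fun hab => lt_asymm hb (hfh a b hab)).trans ha

lemma HasDescent.of_refinement {G : Graph (Option I) E} {f : I → ℕ} {h : I → α} (hf : G.HasDescent f)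
    (hfh : ∀ i j, f i < f j → h i < h j) : G.HasDescent h := fun i =>
  (hf i).imp_right fun ⟨j, hj, hadj⟩ => ⟨j, hfh j i hj, hadj⟩

variable [Finite E] {G : Graph (Option I) E}

lemma sum_outDeg (h : I → α) (S : Finset I) :
    ∑ k ∈ S, G.outDeg h k = ((⋃ k ∈ S, G.outEdges h k).ncard : ℝ) := by
  classical
  induction S using Finset.induction_on with
  | empty => simp
  | insert a S ha ih =>
    rw [Finset.sum_insert ha, ih, Finset.set_biUnion_insert, Set.ncard_union_eq _
      (Set.toFinite _) (Set.toFinite _), outDeg, Nat.cast_add]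
    refine Set.disjoint_left.2 ?_
    rintro e ⟨l, hl, hlt⟩ he
    simp only [Set.mem_iUnion] at he
    obtain ⟨k, hk, l', hl', hlt'⟩ := he
    rcases hl.eq_and_eq_or_eq_and_eq hl' with ⟨h1, -⟩ | ⟨h1, h2⟩
    · exact ha (Option.some_injective _ h1 ▸ hk)
    · rw [Option.some_injective _ h1, Option.some_injective _ h2] at hlt
      exact lt_asymm hlt hlt'

lemma sum_outDeg_le (h : I → α) (S : Finset I) : ∑ k ∈ S, G.outDeg h k ≤ G.inc S := by
  rw [sum_outDeg]
  exact_mod_cast Set.ncard_le_ncard (iUnion_outEdges_subset G h S) (Set.toFinite _)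

/-- Each edge is counted once, at its lower endpoint, and a lower set that contains one endpoint
contains the lower one. -/
lemma IsProper.sum_outDeg_eq {h : I → α} (hh : G.IsProper h) {S : Finset I}
    (hS : IsLowerFor h S) : ∑ k ∈ S, G.outDeg h k = G.inc S := by
  rw [sum_outDeg, inc, (iUnion_outEdges_subset G h S).antisymm]
  rintro e ⟨u, hu, v, he⟩
  simp only [Set.mem_iUnion]
  rcases lt_or_gt_of_ne (hh u v ⟨e, he⟩) with huv | huv
  · exact ⟨u, hu, v, he, huv⟩
  · exact ⟨v, hS u hu v huv, u, he.symm, huv⟩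

variable [Fintype I] [DecidableEq I] (hV : V(G) = Set.univ) (hG : G.toSimpleGraph.Connected)

lemma IsProper.outDeg_mem_basePolyhedron {h : I → α} (hh : G.IsProper h) :
    G.outDeg h ∈ (G.megagreedoid hV hG).basePolyhedron :=
  ⟨fun S => sum_outDeg_le h S.1, fun _ => hh.sum_outDeg_eq fun _ _ j _ => Finset.mem_univ j⟩

lemma sum_le_inc {x : I → ℝ} (hx : x ∈ (G.megagreedoid hV hG).basePolyhedron) {S : Finset I}
    (hS : S ∈ G.rootedFeasible) : ∑ i ∈ S, x i ≤ G.inc S :=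
  hx.1 ⟨S, hS⟩

lemma sum_univ_eq_inc {x : I → ℝ} (hx : x ∈ (G.megagreedoid hV hG).basePolyhedron) :
    ∑ i, x i = G.inc Finset.univ :=
  hx.2 (G.univ_mem_rootedFeasible hV hG)

lemma isLowerFor_insert_lt (f : I → α) (i : I) :
    IsLowerFor f (insert i (Finset.univ.filter fun j => f j < f i)) := by
  intro a ha b hb
  simp only [Finset.mem_insert, Finset.mem_filter, Finset.mem_univ, true_and] at ha ⊢
  rcases ha with rfl | ha
  · exact .inr hb
  · exact .inr (hb.trans ha)

lemma sum_insert_lt (f : I → α) (i : I) (x : I → ℝ) :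
    ∑ j ∈ insert i (Finset.univ.filter fun j => f j < f i), x j =
      x i + ∑ j with f j < f i, x j :=
  Finset.sum_insert (by simp)

/-- The inequalities of lower sets are tight at this point, hence also at `x` if it lies strictly
between `x` and `y`. The lower sets `{h < h i}` and `{h < h i} ∪ {i}` then determine the coordinate
at `i`. -/
lemma HasDescent.outDeg_mem_extremePoints {h : I → α} (hd : G.HasDescent h) (hh : G.IsProper h) :
    G.outDeg h ∈ (G.megagreedoid hV hG).basePolyhedron.extremePoints ℝ := by
  refine ⟨hh.outDeg_mem_basePolyhedron hV hG, fun x hx y hy hxy => ?_⟩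
  obtain ⟨a, b, ha, hb, hab, hxy⟩ := hxy
  have key : ∀ S : Finset I, IsLowerFor h S → ∑ i ∈ S, x i = G.inc S := fun S hS => by
    have h1 := sum_le_inc hV hG hx (hd.mem_rootedFeasible hS)
    have h2 := sum_le_inc hV hG hy (hd.mem_rootedFeasible hS)
    have h3 := hh.sum_outDeg_eq hS
    rw [← hxy] at h3
    simp only [Pi.add_apply, Pi.smul_apply, smul_eq_mul, Finset.sum_add_distrib,
      ← Finset.mul_sum] at h3
    refine h1.antisymm (le_of_not_gt fun hlt => ?_)
    have h4 := mul_lt_mul_of_pos_left hlt ha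
    have h5 := mul_le_mul_of_nonneg_left h2 hb.le
    have h6 : a * (G.inc S : ℝ) + b * G.inc S = G.inc S := by rw [← add_mul, hab, one_mul]
    linarith
  funext i
  have h1 := key _ (isLowerFor_insert_lt h i)
  rw [← hh.sum_outDeg_eq (isLowerFor_insert_lt h i), sum_insert_lt, sum_insert_lt,
    key _ (isLowerFor_lt h i), ← hh.sum_outDeg_eq (isLowerFor_lt h i)] at h1
  linarith

lemma HasDescent.isMinOn_outDeg {f : I → ℕ} {h : I → α} (hf : G.HasDescent f) (hh : G.IsProper h)
    (hfh : ∀ i j, f i < f j → h i < h j) :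
    IsMinOn (fun x : I → ℝ => ∑ i, (f i : ℝ) * x i) (G.megagreedoid hV hG).basePolyhedron
      (G.outDeg h) := by
  intro x hx
  obtain ⟨n, hn⟩ : ∃ n, ∀ i, f i ≤ n :=
    ⟨Finset.univ.sup f, fun i => Finset.le_sup (Finset.mem_univ i)⟩
  have hsum := sum_natCast_mul_eq hn (y := fun i => x i - G.outDeg h i) (by
    rw [Finset.sum_sub_distrib, sum_univ_eq_inc hV hG hx,
      sum_univ_eq_inc hV hG (hh.outDeg_mem_basePolyhedron hV hG), sub_self])
  have hnonneg : 0 ≤ ∑ c ∈ Finset.range n, -∑ i with f i ≤ c, (x i - G.outDeg h i) := by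
    refine Finset.sum_nonneg fun c _ => ?_
    rw [Finset.sum_sub_distrib, hh.sum_outDeg_eq (isLowerFor_le_of_refinement hfh c)]
    linarith [sum_le_inc hV hG hx (hf.mem_rootedFeasible (isLowerFor_le f c))]
  rw [← hsum] at hnonneg
  simp only [mul_sub, Finset.sum_sub_distrib] at hnonneg
  change ∑ i, (f i : ℝ) * G.outDeg h i ≤ ∑ i, (f i : ℝ) * x i
  linarith

/-- Minimality forces equality on every sublevel set. Adding one element `i` to `{f < f i}` bounds
each coordinate of `x` by that of `outDeg f`, and the equal totals turn these bounds into
equalities. -/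
lemma HasDescent.eq_outDeg_of_isMinOn {f : I → ℕ} (hf : G.HasDescent f) (hp : G.IsProper f)
    {x : I → ℝ} (hx : x ∈ (G.megagreedoid hV hG).basePolyhedron)
    (hmin : IsMinOn (fun x : I → ℝ => ∑ i, (f i : ℝ) * x i) (G.megagreedoid hV hG).basePolyhedron
      x) : x = G.outDeg f := by
  obtain ⟨n, hn⟩ : ∃ n, ∀ i, f i ≤ n :=
    ⟨Finset.univ.sup f, fun i => Finset.le_sup (Finset.mem_univ i)⟩
  have hmem := hp.outDeg_mem_basePolyhedron hV hG
  have hzero : ∑ i, (x i - G.outDeg f i) = 0 := by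
    rw [Finset.sum_sub_distrib, sum_univ_eq_inc hV hG hx, sum_univ_eq_inc hV hG hmem, sub_self]
  have hlow : ∀ S : Finset I, IsLowerFor f S → ∑ i ∈ S, (x i - G.outDeg f i) ≤ 0 := fun S hS => by
    rw [Finset.sum_sub_distrib, hp.sum_outDeg_eq hS]
    linarith [sum_le_inc hV hG hx (hf.mem_rootedFeasible hS)]
  have hsum := sum_natCast_mul_eq hn hzero
  have hle : ∑ c ∈ Finset.range n, -∑ i with f i ≤ c, (x i - G.outDeg f i) ≤ 0 := by
    rw [← hsum]
    simp only [mul_sub, Finset.sum_sub_distrib]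
    have : ∑ i, (f i : ℝ) * x i ≤ ∑ i, (f i : ℝ) * G.outDeg f i := hmin hmem
    linarith
  have hnonneg : ∀ c ∈ Finset.range n, 0 ≤ -∑ i with f i ≤ c, (x i - G.outDeg f i) :=
    fun c _ => neg_nonneg.2 (hlow _ (isLowerFor_le f c))
  have htight := (Finset.sum_eq_zero_iff_of_nonneg hnonneg).1
    (hle.antisymm (Finset.sum_nonneg hnonneg))
  have hlt : ∀ i, ∑ j with f j < f i, (x j - G.outDeg f j) = 0 := fun i => by
    rcases Nat.eq_zero_or_pos (f i) with hi | hi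
    · simp [hi]
    · have h1 := htight (f i - 1) (Finset.mem_range.2 (by have := hn i; omega))
      have h2 : ∀ j, f j < f i ↔ f j ≤ f i - 1 := fun j => by omega
      simp only [h2]
      linarith
  have hpos : ∀ i, x i - G.outDeg f i ≤ 0 := fun i => by
    have h1 := hlow _ (isLowerFor_insert_lt f i)
    rw [sum_insert_lt f i fun j => x j - G.outDeg f j, hlt i] at h1
    linarith
  funext i
  have := (Finset.sum_eq_zero_iff_of_nonpos fun i _ => hpos i).1 hzero i (Finset.mem_univ i)
  linarith

lemma exists_refinements [G.Loopless] {f : I → ℕ} {i j : I} (hij : f i = f j)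
    (hadj : G.Adj (some i) (some j)) :
    ∃ h₁ h₂ : I → ℕ ×ₗ ℕ, G.IsProper h₁ ∧ G.IsProper h₂ ∧ (∀ a b, f a < f b → h₁ a < h₁ b) ∧
      (∀ a b, f a < f b → h₂ a < h₂ b) ∧ G.outDeg h₁ ≠ G.outDeg h₂ := by
  obtain ⟨N, r, hr, hrN⟩ : ∃ (N : ℕ) (r : I → ℕ), (∀ a b, r a = r b → a = b) ∧ ∀ a, r a < N :=
    ⟨Fintype.card I, fun a => Fintype.equivFin I a,
      fun _ _ h => (Fintype.equivFin I).injective (Fin.ext h), fun a => (Fintype.equivFin I a).2⟩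
  have hproper : ∀ t : I → ℕ, (∀ a b, t a = t b → a = b) →
      G.IsProper fun a => toLex (f a, t a) := fun t ht a b hab heq => by
    have h1 := congrArg (fun p => (ofLex p).2) heq
    rw [ht a b h1] at hab
    exact G.not_adj_self _ hab
  have hrefine : ∀ (t : I → ℕ) a b, f a < f b → toLex (f a, t a) < toLex (f b, t b) :=
    fun t a b hab => Prod.Lex.toLex_lt_toLex.2 (.inl hab)
  -- Ties are broken by an enumeration `r` of `I`, with `i` moved first in one case and last in the
  -- other. The edge from `i` to `j` is then counted at `i` only in the first case.
  refine ⟨fun a => toLex (f a, if a = i then 0 else r a + 1),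
    fun a => toLex (f a, if a = i then N else r a), hproper _ fun a b hab => ?_,
    hproper _ fun a b hab => ?_, hrefine _, hrefine _, fun heq => ?_⟩
  · split_ifs at hab with ha hb hb
    · rw [ha, hb]
    · exact hr a b (by omega)
  · have := hrN a
    have := hrN b
    split_ifs at hab with ha hb hb
    · rw [ha, hb]
    · omega
    · omega
    · exact hr a b hab
  · have hji : j ≠ i := fun h => by
      rw [h] at hadj
      exact G.not_adj_self _ hadj
    refine absurd (congrFun heq i) (ne_of_gt ?_)
    obtain ⟨e, he⟩ := hadj
    unfold outDeg
    refine Nat.cast_lt.2 (Set.ncard_lt_ncard ((Set.ssubset_iff_of_subset ?_).2 ⟨e, ?_, ?_⟩)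
      (Set.toFinite _))
    · rintro e' ⟨l, hl, hlt⟩
      refine ⟨l, hl, ?_⟩
      have := hrN l
      simp only [Prod.Lex.toLex_lt_toLex, if_true] at hlt ⊢
      rcases hlt with hlt | ⟨-, hlt⟩
      · exact .inl hlt
      · split_ifs at hlt <;> omega
    · exact ⟨j, he, Prod.Lex.toLex_lt_toLex.2 (.inr ⟨hij, by simp [hji]⟩)⟩
    · rintro ⟨l, hl, hlt⟩
      have hlj : l = j := Option.some_injective _ (hl.right_unique he)
      subst hlj
      have := hrN l
      simp only [Prod.Lex.toLex_lt_toLex, hji, if_true, if_false] at hlt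
      omega

theorem isGeneric_iff [G.Loopless] (f : I → ℕ) :
    (G.megagreedoid hV hG).IsGeneric (fun i => (f i : ℝ)) ↔ G.HasDescent f ∧ G.IsProper f := by
  have hcast : G.HasDescent (fun i => (f i : ℝ)) ↔ G.HasDescent f := by
    simp only [HasDescent, Nat.cast_lt]
  rw [Megagreedoid.IsGeneric, isStronglyFeasibleFun_iff_hasDescent, hcast]
  refine and_congr_right fun hf => ⟨?_, fun hp => ?_⟩
  · rintro ⟨v, -, hv⟩ i j hadj hij
    obtain ⟨h₁, h₂, hp₁, hp₂, hr₁, hr₂, hne⟩ := exists_refinements hij hadj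
    exact hne ((hv _ ⟨(hf.of_refinement hr₁).outDeg_mem_extremePoints hV hG hp₁,
      hf.isMinOn_outDeg hV hG hp₁ hr₁⟩).trans
      (hv _ ⟨(hf.of_refinement hr₂).outDeg_mem_extremePoints hV hG hp₂,
        hf.isMinOn_outDeg hV hG hp₂ hr₂⟩).symm)
  · exact ⟨G.outDeg f, ⟨hf.outDeg_mem_extremePoints hV hG hp,
      hf.isMinOn_outDeg hV hG hp fun _ _ => id⟩,
      fun x hx => hf.eq_outDeg_of_isMinOn hV hG hp hx.1.1 hx.2⟩

end BasePolyhedron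

end Graph

/-! ### Generic functions as labelled acyclic orientations. -/

namespace Graph

/-- Extension of `f` to the root by zero. -/
def extendRoot {I : Type*} (f : I → ℕ) (v : Option I) : ℕ := v.elim 0 f

namespace Orientation

section

variable {V E : Type*} {G : Graph V E}

lemma ext_of_decreasing {o o' : G.Orientation} {F : V → ℕ} (h : ∀ e, F (o.head e) < F (o.tail e))
    (h' : ∀ e, F (o'.head e) < F (o'.tail e)) : o = o' := by
  have key : ∀ e, o.tail e = o'.tail e ∧ o.head e = o'.head e := fun e => by
    rcases (o.isLink e).eq_and_eq_or_eq_and_eq (o'.isLink e) with h1 | ⟨h1, h2⟩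
    · exact h1
    · have h3 := h e
      rw [h1, h2] at h3
      exact absurd h3 (h' e).asymm
  exact Orientation.ext (funext fun e => (key e).1) (funext fun e => (key e).2)

lemma isAcyclic_of_decreasing {o : G.Orientation} {F : V → ℕ}
    (h : ∀ e, F (o.head e) < F (o.tail e)) : o.IsAcyclic := by
  have key : ∀ u v, Relation.TransGen (o.ArcIn Set.univ) u v → F v < F u := fun u v huv => by
    have harc : ∀ a b, o.ArcIn Set.univ a b → F b < F a := by
      rintro _ _ ⟨e, -, rfl, rfl⟩
      exact h e
    induction huv with
    | single h1 => exact harc _ _ h1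
    | tail _ h1 ih => exact (harc _ _ h1).trans ih
  exact fun v hv => lt_irrefl _ (key v v hv)

lemma exists_decreasing {F : V → ℕ} (h : ∀ u v, G.Adj u v → F u ≠ F v) :
    ∃ o : G.Orientation, ∀ e, F (o.head e) < F (o.tail e) := by
  have key : ∀ e : E(G), ∃ p : V × V, G.IsLink e p.1 p.2 ∧ F p.2 < F p.1 := fun e => by
    obtain ⟨u, v, huv⟩ := exists_isLink_of_mem_edgeSet e.2
    rcases lt_or_gt_of_ne (h u v ⟨e, huv⟩) with hlt | hlt
    · exact ⟨(v, u), huv.symm, hlt⟩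
    · exact ⟨(u, v), huv, hlt⟩
  choose p hp hlt using key
  exact ⟨⟨fun e => (p e).1, fun e => (p e).2, hp⟩, hlt⟩

lemma finite [Finite V] [Finite E] (G : Graph V E) : Finite G.Orientation :=
  Finite.of_injective (fun o : G.Orientation => (o.tail, o.head)) fun _ _ h =>
    Orientation.ext (congrArg Prod.fst h) (congrArg Prod.snd h)

/-- In an acyclic orientation with sink `r`, a spanning tree directed towards `r` exists as soon as
every other vertex has an outgoing edge. -/
lemma IsAcyclic.exists_isDirectedSpanningTree_iff [Finite V] {o : G.Orientation}
    (ha : o.IsAcyclic) {r : V} (hr : o.IsSink r) :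
    (∃ T, o.IsDirectedSpanningTree r T) ↔ ∀ v ∈ V(G), v ≠ r → ∃ e, o.tail e = v := by
  constructor
  · rintro ⟨T, hT⟩ v hv hvr
    obtain ⟨e, he, -⟩ := hT.existsUnique v hv hvr
    exact ⟨e, he.2⟩
  · intro h
    choose s hs using h
    -- The tree keeps one chosen outgoing edge per non-root vertex; acyclicity gives the
    -- well-founded induction showing that these edges lead to `r`.
    refine ⟨{e | ∃ v hv hvr, s v hv hvr = e}, fun e _ => hr e, fun v hv hvr => ?_, fun v => ?_⟩
    · refine ⟨s v hv hvr, ⟨⟨v, hv, hvr, rfl⟩, hs v hv hvr⟩, ?_⟩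
      rintro _ ⟨⟨w, hw, hwr, rfl⟩, hwv⟩
      have hwv' : w = v := (hs w hw hwr).symm.trans hwv
      subst hwv'
      rfl
    · have : Std.Irrefl (Function.swap (Relation.TransGen (o.ArcIn Set.univ))) := ⟨ha⟩
      have : IsTrans V (Function.swap (Relation.TransGen (o.ArcIn Set.univ))) :=
        ⟨fun _ _ _ h1 h2 => h2.trans h1⟩
      induction v using (Finite.wellFounded_of_trans_of_irrefl
        (Function.swap (Relation.TransGen (o.ArcIn Set.univ)))).induction with
      | h v ih =>
        intro hv
        by_cases hvr : v = r
        · rw [hvr]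
        · exact (ih (o.head (s v hv hvr)) (.single ⟨_, trivial, hs v hv hvr, rfl⟩)
            (o.isLink _).right_mem).head ⟨_, ⟨v, hv, hvr, rfl⟩, hs v hv hvr, rfl⟩

end

section Rooted

variable {I E : Type*} {G : Graph (Option I) E}

/-- The acyclic orientations in which the root is the only sink. -/
def rootedAcyclic (G : Graph (Option I) E) : Set G.Orientation :=
  {o | o.IsAcyclic ∧ o.IsSink none ∧ ∀ i, ∃ e, o.tail e = some i}

/-- The arcs of an orientation between vertices other than the root. -/
def arc (o : G.Orientation) (i j : I) : Prop := o.ArcIn Set.univ (some i) (some j)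

lemma IsAcyclic.not_transGen_arc {o : G.Orientation} (ha : o.IsAcyclic) (i : I) :
    ¬ Relation.TransGen o.arc i i := fun h => ha (some i) (h.lift some fun _ _ => id)

lemma mem_strictMaps_arc_iff [Fintype I] [DecidableEq I] {o : G.Orientation} (hr : o.IsSink none)
    {n : ℕ} {f : I → ℕ} :
    f ∈ strictMaps o.arc Finset.univ n ↔ (∀ i, 1 ≤ f i ∧ f i ≤ n) ∧
      ∀ e, extendRoot f (o.head e) < extendRoot f (o.tail e) := by
  simp only [mem_strictMaps, Finset.mem_univ, true_implies, not_true, false_implies,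
    implies_true, true_and]
  refine and_congr_right fun hf => ⟨fun h e => ?_, fun h i j hij => ?_⟩
  · obtain ⟨i, hi⟩ := Option.ne_none_iff_exists.1 (hr e)
    rcases hj : o.head e with _ | j
    · rw [← hi]
      exact (hf i).1
    · rw [← hi]
      exact h i j ⟨e, trivial, hi.symm, hj⟩
  · obtain ⟨e, -, h1, h2⟩ := hij
    have := h e
    rwa [h1, h2] at this

/-- The maps counted by the generic polynomial are those that decrease strictly along the arcs of an
acyclic orientation with the root as its only sink. -/
lemma hasDescent_and_isProper_iff {f : I → ℕ} [G.Loopless] (hf : ∀ i, 1 ≤ f i) :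
    (G.HasDescent f ∧ G.IsProper f) ↔ ∃ o ∈ rootedAcyclic G,
      ∀ e, extendRoot f (o.head e) < extendRoot f (o.tail e) := by
  constructor
  · rintro ⟨hd, hp⟩
    obtain ⟨o, ho⟩ := exists_decreasing (G := G) (F := extendRoot f) (by
      rintro (_ | i) (_ | j) hadj
      · exact absurd hadj (G.not_adj_self _)
      · exact (Nat.lt_of_succ_le (hf j)).ne
      · exact (Nat.lt_of_succ_le (hf i)).ne'
      · exact hp i j hadj)
    have htail : ∀ u v, G.Adj u v → extendRoot f v < extendRoot f u → ∃ e, o.tail e = u := by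
      rintro u v ⟨e, he⟩ hlt
      refine ⟨⟨e, he.edge_mem⟩, ?_⟩
      rcases (o.isLink ⟨e, he.edge_mem⟩).eq_and_eq_or_eq_and_eq he with ⟨h1, -⟩ | ⟨h1, h2⟩
      · exact h1
      · have := ho ⟨e, he.edge_mem⟩
        rw [h1, h2] at this
        exact absurd this hlt.asymm
    refine ⟨o, ⟨isAcyclic_of_decreasing ho, fun e he => ?_, fun i => ?_⟩, ho⟩
    · have := ho e
      rw [he] at this
      exact Nat.not_lt_zero _ this
    · rcases hd i with h | ⟨j, hj, h⟩
      · exact htail _ _ h (hf i)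
      · exact htail _ _ h hj
  · rintro ⟨o, ⟨-, -, hout⟩, ho⟩
    refine ⟨fun i => ?_, fun i j => ?_⟩
    · obtain ⟨e, he⟩ := hout i
      have hlt := ho e
      have hl := o.isLink e
      rw [he] at hlt hl
      rcases hj : o.head e with _ | j
      · rw [hj] at hl
        exact .inl ⟨_, hl⟩
      · rw [hj] at hl hlt
        exact .inr ⟨j, hlt, _, hl⟩
    · rintro ⟨e, he⟩ hij
      have hlt := ho ⟨e, he.edge_mem⟩
      rcases (o.isLink ⟨e, he.edge_mem⟩).eq_and_eq_or_eq_and_eq he with ⟨h1, h2⟩ | ⟨h1, h2⟩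
      · rw [h1, h2] at hlt
        exact hlt.ne' hij
      · rw [h1, h2] at hlt
        exact hlt.ne hij

/-- The union over orientations is disjoint because a labelling that decreases along all arcs
determines the orientation. -/
lemma genericCount_eq_sum [Fintype I] [DecidableEq I] [Finite E] [G.Loopless]
    (hV : V(G) = Set.univ) (hG : G.toSimpleGraph.Connected) (hfin : (rootedAcyclic G).Finite)
    (n : ℕ) : (G.megagreedoid hV hG).genericCount n =
      ∑ o ∈ hfin.toFinset, (strictMaps o.arc Finset.univ n).card := by
  classical
  rw [← Finset.card_biUnion, ← Set.ncard_coe_finset, Megagreedoid.genericCount]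
  · congr 1
    ext f
    simp only [Set.mem_ofPred_eq, isGeneric_iff, Finset.coe_biUnion, Set.mem_iUnion, Finset.mem_coe,
      Set.Finite.mem_toFinset]
    constructor
    · rintro ⟨hf, h⟩
      obtain ⟨o, ho, hlt⟩ := (hasDescent_and_isProper_iff fun i => (hf i).1).1 h
      exact ⟨o, ho, (mem_strictMaps_arc_iff ho.2.1).2 ⟨hf, hlt⟩⟩
    · rintro ⟨o, ho, h⟩
      obtain ⟨hf, hlt⟩ := (mem_strictMaps_arc_iff ho.2.1).1 h
      exact ⟨hf, (hasDescent_and_isProper_iff fun i => (hf i).1).2 ⟨o, ho, hlt⟩⟩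
  · intro o ho o' ho' hne
    rw [Finset.mem_coe, Set.Finite.mem_toFinset] at ho ho'
    refine Finset.disjoint_left.2 fun f h h' => hne ?_
    exact ext_of_decreasing ((mem_strictMaps_arc_iff ho.2.1).1 h).2
      ((mem_strictMaps_arc_iff ho'.2.1).1 h').2

end Rooted

end Orientation

end Graph

theorem mainTheorem6 {I E : Type*} [Fintype I] [DecidableEq I] [Finite E]
    (G : Graph (Option I) E) [G.Loopless] (hV : G.vertexSet = Set.univ)
    (hG : G.toSimpleGraph.Connected) :
    ∃ p : Polynomial ℚ, (G.megagreedoid hV hG).IsGenericPolynomial p ∧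
      (-1 : ℚ) ^ Fintype.card I * p.eval (-1) =
        (Set.ncard {o : G.Orientation | o.IsAcyclic ∧ o.IsSink none ∧
          ∃ T, o.IsDirectedSpanningTree none T} : ℚ) := by
  have := Graph.Orientation.finite G
  have hfin : (Graph.Orientation.rootedAcyclic G).Finite := Set.toFinite _
  choose! P hP hP' using fun (o : G.Orientation) (ho : o.IsAcyclic) =>
    exists_strictOrderPolynomial ho.not_transGen_arc Finset.univ
  refine ⟨∑ o ∈ hfin.toFinset, P o, fun n => ?_, ?_⟩
  · rw [Graph.Orientation.genericCount_eq_sum hV hG hfin, Polynomial.eval_finsetSum, Nat.cast_sum]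
    exact Finset.sum_congr rfl fun o ho => hP o (hfin.mem_toFinset.1 ho).1 n
  · have hset : {o : G.Orientation | o.IsAcyclic ∧ o.IsSink none ∧
        ∃ T, o.IsDirectedSpanningTree none T} = Graph.Orientation.rootedAcyclic G := by
      ext o
      refine and_congr_right fun ha => and_congr_right fun hr => ?_
      rw [ha.exists_isDirectedSpanningTree_iff hr, hV]
      refine ⟨fun h i => h (some i) trivial (Option.some_ne_none i), ?_⟩
      rintro h (_ | i) - hne
      · exact absurd rfl hne
      · exact h i
    rw [hset, Set.ncard_eq_toFinset_card _ hfin, Polynomial.eval_finsetSum,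
      Finset.sum_congr rfl fun o ho => hP' o (hfin.mem_toFinset.1 ho).1, Finset.sum_const,
      nsmul_eq_mul, Finset.card_univ, mul_left_comm, ← pow_add, Even.neg_one_pow ⟨_, rfl⟩, mul_one]
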